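/- Let $m,n,k$ be natural numbers with $1 \le k < \min\{m,n\}$. Let $\mathcal{H}_m=\mathbb{C}^m$ and $\mathcal{H}_n=\mathbb{C}^n$ with the standard inner products, and let $\mathcal{L}(\mathcal{H}_m)\otimes\mathcal{L}(\mathcal{H}_n)$ be the algebra of linear operators on $\mathcal{H}_m\otimes\mathcal{H}_n$. The Schmidt rank $SR(w)$ of a vector $w=\sum_{i,j} w_{ij}\, e_i\otimes e_j \in \mathcal{H}_m\otimes\mathcal{H}_n$ is the rank of the $m\times n$ matrix $(w_{ij})$, i.e. the number of non-zero terms in a Schmidt decomposition of $w$. Define $$\mathcal{S}_k := \{\, c\, ww^* : c\in\mathbb{R},\ w\in\mathcal{H}_m\otimes\mathcal{H}_n,\ \|w\|=1,\ SR(w)\le k \,\}.$$ When $m=n$, let $S$ be the swap operator, $S(a\otimes b)=b\otimes a$. Consider the operators on $\mathcal{H}_m\otimes\mathcal{H}_n$ of the form $$(1)\quad L = P\otimes Q \quad\text{ or }\quad m=n \text{ and } L = S(P\otimes Q)$$ with $P\in\mathcal{L}(\mathcal{H}_m)$ and $Q\in\mathcal{L}(\mathcal{H}_n)$ nonsingular,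 and those of the form $$(2)\quad U = W\otimes Y \quad\text{ or }\quad m=n \text{ and } U = S(W\otimes Y)$$ with $W\in\mathcal{L}(\mathcal{H}_m)$ and $Y\in\mathcal{L}(\mathcal{H}_n)$ unitary. Let $\Phi$ be an invertible completely positive linear map from $\mathcal{L}(\mathcal{H}_m)\otimes\mathcal{L}(\mathcal{H}_n)$ to itself. Then $\Phi(\mathcal{S}_k)\subseteq\mathcal{S}_k$ if and only if there is an invertible operator $L$ of the form (1) such that $\Phi(X)=LXL^*$ for all $X$. Suppose in addition that $\Phi$ is trace-preserving, i.e. $\mathrm{Tr}(\Phi(X))=\mathrm{Tr}(X)$ for all $X$. Then every $L$ of the form (1) with $\Phi(X)=LXL^*$ for all $X$ is a unitary of the form (2); in particular, $\Phi(\mathcal{S}_k)\subseteq\mathcal{S}_k$ if and only if there is a unitary $L$ of the form (2) such that $\Phi(X)=LXL^*$ for all $X$. -/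

import Mathlib

open scoped Matrix Kronecker CStarAlgebra MatrixOrder Matrix.Norms.L2Operator

noncomputable section

namespace Bipartite

/-- Operators on `ℂ^m ⊗ ℂ^n`, written as matrices in the product basis `e_i ⊗ e_j`. Under this
identification the operator `P ⊗ Q` is the Kronecker product `P ⊗ₖ Q`. The order on matrices is
the Loewner order. -/
abbrev Op (m n : ℕ) : Type := Matrix (Fin m × Fin n) (Fin m × Fin n) ℂ

/-- The operator `A_v : ℂ^n → ℂ^m` associated with a vector `v` of `ℂ^m ⊗ ℂ^n` by the
vector-operator isomorphism, which sends `a ⊗ b` to the matrix with entries `a i * b j`. -/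
def vecToOp {m n : ℕ} (v : EuclideanSpace ℂ (Fin m × Fin n)) : Matrix (Fin m) (Fin n) ℂ :=
  Matrix.of fun i j => v (i, j)

/-- The Schmidt rank of a vector `v` of `ℂ^m ⊗ ℂ^n`: the rank of its associated operator, that is,
the number of non-zero singular values (Schmidt coefficients). -/
def schmidtRank {m n : ℕ} (v : EuclideanSpace ℂ (Fin m × Fin n)) : ℕ :=
  (vecToOp v).rank

/-- The operator `|w⟩⟨w|`. -/
def ketbra {m n : ℕ} (w : EuclideanSpace ℂ (Fin m × Fin n)) : Op m n :=
  Matrix.of fun p q => w p * star (w q)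

/-- The set of real multiples of projections onto pure states (unit vectors) of Schmidt rank at
most `k`. -/
def stateMultiples (m n k : ℕ) : Set (Op m n) :=
  {X | ∃ (c : ℝ) (w : EuclideanSpace ℂ (Fin m × Fin n)),
    ‖w‖ = 1 ∧ schmidtRank w ≤ k ∧ X = (c : ℂ) • ketbra w}

/-- The swap operator `S (a ⊗ b) = b ⊗ a`, where `ℂ^m` and `ℂ^n` are identified along `m = n`. -/
def swapOp {m n : ℕ} (h : m = n) : Op m n :=
  Matrix.of fun p q => if p.1 = Fin.cast h.symm q.2 ∧ p.2 = Fin.cast h q.1 then 1 else 0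

/-- Operators of the form `P ⊗ Q`, or (if `m = n`) `S (P ⊗ Q)`, with `P`, `Q` nonsingular. -/
def IsLocalNonsingular {m n : ℕ} (L : Op m n) : Prop :=
  (∃ (P : Matrix (Fin m) (Fin m) ℂ) (Q : Matrix (Fin n) (Fin n) ℂ),
      IsUnit P ∧ IsUnit Q ∧ L = P ⊗ₖ Q) ∨
  (∃ (h : m = n) (P : Matrix (Fin m) (Fin m) ℂ) (Q : Matrix (Fin n) (Fin n) ℂ),
      IsUnit P ∧ IsUnit Q ∧ L = swapOp h * (P ⊗ₖ Q))

/-- Operators of the form `W ⊗ Y`, or (if `m = n`) `S (W ⊗ Y)`, with `W`, `Y` unitary. -/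
def IsLocalUnitary {m n : ℕ} (U : Op m n) : Prop :=
  (∃ (W : Matrix (Fin m) (Fin m) ℂ) (Y : Matrix (Fin n) (Fin n) ℂ),
      W ∈ Matrix.unitaryGroup (Fin m) ℂ ∧ Y ∈ Matrix.unitaryGroup (Fin n) ℂ ∧ U = W ⊗ₖ Y) ∨
  (∃ (h : m = n) (W : Matrix (Fin m) (Fin m) ℂ) (Y : Matrix (Fin n) (Fin n) ℂ),
      W ∈ Matrix.unitaryGroup (Fin m) ℂ ∧ Y ∈ Matrix.unitaryGroup (Fin n) ℂ ∧
        U = swapOp h * (W ⊗ₖ Y))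

end Bipartite

end

namespace Bipartite

/-! Arranging the coordinates of a vector in an m × n matrix turns Schmidt rank into rank, `P ⊗ₖ Q`
into `A ↦ P A Qᵀ`, and the swap into transposition. The hard direction then has two halves.

Φ has a single Kraus operator (`exists_eq_conj_of_rank_le_one`). If F(w) is the matrix with columns
K_s w, then Φ(ww*) = F(w)F(w)*, so F(w) has rank at most one for every product vector w. As one
tensor factor varies, these matrices form a linear space and share a left or a right factor
(`common_factor`). A shared left factor would make Φ send independent projections to proportional
operators, against injectivity. A shared right factor makes all K_s proportional, whence Φ(X) =
LXL*.

L is local (`isLocalNonsingular_of_rank_le`). It induces a bijection of matrices that keeps rank at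
most k. A first-order perturbation argument lowers k by one at a time (`rank_map_le_of_succ`) down
to 1, and maps preserving rank one are `A ↦ P A Qᵀ` or `A ↦ P Aᵀ Qᵀ` (`rank_one_preserver`); the
second forces m = n and yields the swap.

Trace preservation gives L*L = 1, and a unitary Kronecker product rescales to a product of
unitaries. -/

/-! ### Kraus decomposition of completely positive maps -/

theorem exists_eq_star_mul_self {A : Type*} [NonUnitalCStarAlgebra A] [PartialOrder A]
    [StarOrderedRing A] {a : A} (h : 0 ≤ a) : ∃ b, a = star b * b :=
  CStarAlgebra.nonneg_iff_eq_star_mul_self.mp h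

/-- Choi's argument: the block matrix of all matrix units is positive, so its image under Φ is some
B*B, and the conjugated rows of B are the Kraus operators. -/
theorem exists_kraus {ι κ : Type*} [Fintype ι] [DecidableEq ι] [Nonempty ι] [Fintype κ]
    [DecidableEq κ] (Φ : Matrix ι ι ℂ →CP Matrix κ κ ℂ) :
    ∃ K : ι × κ → Matrix κ ι ℂ, ∀ X, Φ X = ∑ s, K s * X * (K s)ᴴ := by
  classical
  obtain ⟨i₀⟩ := ‹Nonempty ι›
  -- Only row `i₀` of `M` is nonzero, so the (i, j) block of M*M is E_{i i₀} E_{i₀ j} = E_{ij}.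
  let M : CStarMatrix ι ι (Matrix ι ι ℂ) :=
    CStarMatrix.ofMatrix (Matrix.of fun l j => if l = i₀ then Matrix.single i₀ j 1 else 0)
  have hM : ∀ l j, M l j = if l = i₀ then Matrix.single i₀ j 1 else 0 := fun _ _ => rfl
  have h := Φ.map_cstarMatrix_nonneg (star M * M) (star_mul_self_nonneg M)
  obtain ⟨B, hB⟩ := exists_eq_star_mul_self h
  have key : ∀ i j, Φ (Matrix.single i j 1) = ∑ l, (B l i)ᴴ * B l j := by
    intro i j
    have := congrFun (congrFun hB i) j
    simp only [CStarMatrix.map_apply, CStarMatrix.mul_apply, CStarMatrix.star_apply,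
      Matrix.star_eq_conjTranspose, hM] at this
    rw [← this, Finset.sum_eq_single i₀]
    · simp
    · intro b _ hb
      simp [hb]
    · simp
  refine ⟨fun s => Matrix.of fun p i => star (B s.1 i s.2 p), fun X => ?_⟩
  ext p q
  conv_lhs => rw [Matrix.matrix_eq_sum_single X]
  have : ∀ i j, Matrix.single i j (X i j) = X i j • Matrix.single i j (1 : ℂ) := by simp
  simp_rw [this, map_sum, map_smul, key]
  simp only [Matrix.sum_apply, Matrix.smul_apply, Matrix.mul_apply, Matrix.conjTranspose_apply,
    Matrix.of_apply, star_star, smul_eq_mul, Fintype.sum_prod_type, Finset.mul_sum, Finset.sum_mul]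
  rw [Finset.sum_comm]
  simp_rw [fun j => Finset.sum_comm (s := (Finset.univ : Finset ι)) (t := Finset.univ)
    (f := fun i l => ∑ r, X i j * (star (B l i r p) * B l j r q))]
  rw [Finset.sum_comm]
  refine Finset.sum_congr rfl fun l _ => ?_
  simp_rw [fun j => Finset.sum_comm (s := (Finset.univ : Finset ι)) (t := Finset.univ)
    (f := fun i r => X i j * (star (B l i r p) * B l j r q))]
  rw [Finset.sum_comm]
  refine Finset.sum_congr rfl fun r _ => Finset.sum_congr rfl fun j _ =>
    Finset.sum_congr rfl fun i _ => ?_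
  ring

/-! ### Linear spaces of rank-one matrices -/

open Matrix

variable {K : Type*} [Field K]

theorem exists_eq_vecMulVec_of_rank_le_one {α β : Type*} [Fintype β] {A : Matrix α β K}
    (h : A.rank ≤ 1) : ∃ x y, A = vecMulVec x y := by
  classical
  obtain ⟨v, hv⟩ := finrank_le_one_iff.mp h
  choose c hc using fun j => hv ⟨A *ᵥ Pi.single j 1, Pi.single j 1, rfl⟩
  refine ⟨v, c, ?_⟩
  ext i j
  have := congrFun (congrArg Subtype.val (hc j)) i
  simp only [mulVec_single_one, Submodule.coe_smul, Pi.smul_apply, smul_eq_mul, col_apply] at this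
  rw [← this, vecMulVec_apply, mul_comm]

theorem vecMulVec_left_injective {α β : Type*} {y : β → K} (hy : y ≠ 0) :
    Function.Injective fun x : α → K => vecMulVec x y := by
  intro x x' h
  obtain ⟨j, hj⟩ := Function.ne_iff.mp hy
  ext i
  exact mul_right_cancel₀ hj (congrFun (congrFun h i) j)

theorem vecMulVec_right_injective {α β : Type*} {x : α → K} (hx : x ≠ 0) :
    Function.Injective fun y : β → K => vecMulVec x y := by
  intro y y' h
  obtain ⟨i, hi⟩ := Function.ne_iff.mp hx
  ext j
  exact mul_left_cancel₀ hi (congrFun (congrFun h i) j)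

theorem vecMulVec_ne_zero_of {α β : Type*} {x : α → K} {y : β → K} (hx : x ≠ 0) (hy : y ≠ 0) :
    vecMulVec x y ≠ 0 := fun h =>
  hx (vecMulVec_left_injective hy (h.trans (zero_vecMulVec y).symm))

theorem eq_smul_of_vecMulVec_eq {α β : Type*} {x x' : α → K} {y y' : β → K}
    (h : vecMulVec x y = vecMulVec x' y') (hy : y ≠ 0) : ∃ c : K, x = c • x' := by
  obtain ⟨j, hj⟩ := Function.ne_iff.mp hy
  simp only [Pi.zero_apply] at hj
  refine ⟨y' j / y j, ?_⟩
  ext i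
  have := congrFun (congrFun h i) j
  simp only [vecMulVec_apply] at this
  simp only [Pi.smul_apply, smul_eq_mul]
  field_simp
  rw [this, mul_comm]

theorem eq_smul_of_vecMulVec_eq' {α β : Type*} {x x' : α → K} {y y' : β → K}
    (h : vecMulVec x y = vecMulVec x' y') (hx : x ≠ 0) : ∃ c : K, y = c • y' := by
  refine eq_smul_of_vecMulVec_eq (y := x) (y' := x') ?_ hx
  rw [← transpose_vecMulVec, h, transpose_vecMulVec]

/-- Each 2 × 2 minor of the sum is a minor of (x, x₀) times a minor of (y, y₀). All of them vanish
because the sum has rank at most one, so one of the two pairs is dependent. -/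
theorem eq_smul_or_eq_smul_of_vecMulVec_add {α β : Type*} {x x₀ z : α → K} {y y₀ w : β → K}
    (hx₀ : x₀ ≠ 0) (hy₀ : y₀ ≠ 0) (h : vecMulVec x y + vecMulVec x₀ y₀ = vecMulVec z w) :
    (∃ c : K, x = c • x₀) ∨ ∃ c : K, y = c • y₀ := by
  obtain ⟨k, hk⟩ := Function.ne_iff.mp hx₀
  obtain ⟨l, hl⟩ := Function.ne_iff.mp hy₀
  simp only [Pi.zero_apply] at hk hl
  have he : ∀ i j, x i * y j + x₀ i * y₀ j = z i * w j := fun i j => by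
    simpa [vecMulVec_apply] using congrFun (congrFun h i) j
  have key : ∀ i j i' j', (x i * x₀ i' - x i' * x₀ i) * (y j * y₀ j' - y j' * y₀ j) = 0 := by
    intro i j i' j'
    linear_combination (x i' * y j' + x₀ i' * y₀ j') * he i j + z i * w j * he i' j'
      - (x i' * y j + x₀ i' * y₀ j) * he i j' - z i * w j' * he i' j
  by_cases hx : ∀ i, x i * x₀ k - x k * x₀ i = 0
  · refine Or.inl ⟨x k / x₀ k, ?_⟩
    ext i
    simp only [Pi.smul_apply, smul_eq_mul]
    field_simp
    linear_combination hx i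
  · push Not at hx
    obtain ⟨i, hi⟩ := hx
    refine Or.inr ⟨y l / y₀ l, ?_⟩
    ext j
    simp only [Pi.smul_apply, smul_eq_mul]
    field_simp
    linear_combination (mul_eq_zero.mp (key i j k l)).resolve_left hi

/-- A linear space of matrices of rank at most one has a common left or a common right factor. -/
theorem common_factor {V α β : Type*} [AddCommGroup V] [Module K V] (F : V →ₗ[K] Matrix α β K)
    (hF : ∀ v, ∃ x y, F v = vecMulVec x y) :
    (∃ x, ∀ v, ∃ y, F v = vecMulVec x y) ∨ ∃ y, ∀ v, ∃ x, F v = vecMulVec x y := by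
  by_cases h0 : ∀ v, F v = 0
  · exact Or.inl ⟨0, fun v => ⟨0, by simp [h0 v]⟩⟩
  push Not at h0
  obtain ⟨v₀, hv₀⟩ := h0
  obtain ⟨x₀, y₀, h₀⟩ := hF v₀
  have hx₀ : x₀ ≠ 0 := by rintro rfl; simp [h₀] at hv₀
  have hy₀ : y₀ ≠ 0 := by rintro rfl; exact hv₀ (h₀.trans (by ext; simp [vecMulVec_apply]))
  have dich : ∀ v, (∃ y, F v = vecMulVec x₀ y) ∨ ∃ x, F v = vecMulVec x y₀ := by
    intro v
    obtain ⟨x, y, h⟩ := hF v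
    obtain ⟨z, w, h'⟩ := hF (v + v₀)
    rw [map_add, h, h₀] at h'
    rcases eq_smul_or_eq_smul_of_vecMulVec_add hx₀ hy₀ h' with ⟨c, rfl⟩ | ⟨c, rfl⟩
    · exact Or.inl ⟨c • y, by rw [h, smul_vecMulVec, vecMulVec_smul]⟩
    · exact Or.inr ⟨c • x, by rw [h, smul_vecMulVec, vecMulVec_smul]⟩
  by_contra! hc
  obtain ⟨v₁, h₁⟩ := hc.1 x₀
  obtain ⟨v₂, h₂⟩ := hc.2 y₀
  obtain ⟨x₁, e₁⟩ := (dich v₁).resolve_left (by simpa using h₁)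
  obtain ⟨y₂, e₂⟩ := (dich v₂).resolve_right (by simpa using h₂)
  -- `F v₁` has only the right factor `y₀`, `F v₂` only the left factor `x₀`; their sum can have
  -- neither.
  rcases dich (v₁ + v₂) with ⟨y, e⟩ | ⟨x, e⟩
  · refine h₁ (y - y₂) ?_
    rw [map_add, e₂] at e
    rw [vecMulVec_sub, ← e, add_sub_cancel_right]
  · refine h₂ (x - x₁) ?_
    rw [map_add, e₁] at e
    rw [sub_vecMulVec, ← e, add_sub_cancel_left]

/-- If `F` takes rank-one values with a fixed left factor, it factors through that factor. -/
theorem exists_linear_right {V α β : Type*} [AddCommGroup V] [Module K V]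
    {F : V →ₗ[K] Matrix α β K} {x : α → K} (h : ∀ v, ∃ y, F v = vecMulVec x y) :
    ∃ R : V →ₗ[K] (β → K), ∀ v, F v = vecMulVec x (R v) := by
  by_cases hx : x = 0
  · refine ⟨0, fun v => ?_⟩
    obtain ⟨y, hy⟩ := h v
    simp [hy, hx]
  obtain ⟨i, hi⟩ := Function.ne_iff.mp hx
  simp only [Pi.zero_apply] at hi
  refine ⟨(x i)⁻¹ • (LinearMap.proj i : (α → β → K) →ₗ[K] β → K) ∘ₗ F, fun v => ?_⟩
  obtain ⟨y, hy⟩ := h v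
  rw [hy]
  congr 1
  ext j
  have : F v i = x i • y := by
    rw [hy]
    rfl
  change y j = (x i)⁻¹ * F v i j
  simp [this, hi]

theorem exists_linear_left {V α β : Type*} [AddCommGroup V] [Module K V]
    {F : V →ₗ[K] Matrix α β K} {y : β → K} (h : ∀ v, ∃ x, F v = vecMulVec x y) :
    ∃ R : V →ₗ[K] (α → K), ∀ v, F v = vecMulVec (R v) y := by
  obtain ⟨R, hR⟩ := exists_linear_right (F := (transposeLinearEquiv α β K K).toLinearMap ∘ₗ F)
    (x := y) fun v => by
      obtain ⟨x, hx⟩ := h v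
      exact ⟨x, by simp [hx, transpose_vecMulVec]⟩
  refine ⟨R, fun v => ?_⟩
  have := congrArg transpose (hR v)
  simpa [transpose_vecMulVec] using this

theorem linearMap_ext_vecMulVec {V α β : Type*} [AddCommGroup V] [Module K V] [Finite α] [Finite β]
    {F G : Matrix α β K →ₗ[K] V} (h : ∀ a b, F (vecMulVec a b) = G (vecMulVec a b)) : F = G := by
  classical
  cases nonempty_fintype α
  cases nonempty_fintype β
  refine Matrix.ext_linearMap _ fun i j => ?_
  ext
  simpa [← single_eq_single_vecMulVec_single] using h (Pi.single i 1) (Pi.single j 1)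

/-- Comparing the scalars at v, v₀ and v + v₀ shows that they agree, unless v is a multiple of v₀,
where linearity suffices. -/
theorem exists_eq_smul_of_forall {V W : Type*} [AddCommGroup V] [Module K V] [AddCommGroup W]
    [Module K W] {F G : V →ₗ[K] W} (hG : Function.Injective G) (h : ∀ v, ∃ c : K, F v = c • G v) :
    ∃ c : K, ∀ v, F v = c • G v := by
  cases subsingleton_or_nontrivial V
  · exact ⟨0, fun v => by simp [Subsingleton.elim v 0]⟩
  obtain ⟨v₀, hv₀⟩ := exists_ne (0 : V)
  obtain ⟨c₀, hc₀⟩ := h v₀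
  refine ⟨c₀, fun v => ?_⟩
  obtain ⟨c, hc⟩ := h v
  obtain ⟨d, hd⟩ := h (v + v₀)
  have e : (c - d) • v = (d - c₀) • v₀ := by
    apply hG
    rw [map_add, map_add, hc, hc₀] at hd
    rw [map_smul, map_smul, sub_smul, sub_smul, sub_eq_sub_iff_add_eq_add, hd, smul_add, add_comm]
  by_cases h1 : c = d
  · subst h1
    rw [sub_self, zero_smul, eq_comm, smul_eq_zero, or_iff_left hv₀, sub_eq_zero] at e
    rw [hc, e]
  · have : v = ((c - d)⁻¹ * (d - c₀)) • v₀ := by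
      rw [mul_smul, ← e, smul_smul, inv_mul_cancel₀ (sub_ne_zero.mpr h1), one_smul]
    rw [this, map_smul, map_smul, hc₀, smul_comm]

/-! ### Linear maps preserving rank one -/

/-- `A ↦ P A Qᵀ` sends `a bᵀ` to `(P a) (Q b)ᵀ`. -/
theorem mul_vecMulVec_mul_transpose {α β γ δ : Type*} [Fintype α] [Fintype β] (P : Matrix γ α K)
    (Q : Matrix δ β K) (a : α → K) (b : β → K) :
    P * vecMulVec a b * Qᵀ = vecMulVec (P *ᵥ a) (Q *ᵥ b) := by
  rw [mul_vecMulVec, vecMulVec_mul, vecMul_transpose]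

/-- A linear injection preserving the left and the right factors of rank-one matrices
is of the form `A ↦ P A Qᵀ`. -/
theorem exists_eq_mul_mul_transpose_of_factors {α β γ δ : Type*} [Fintype α] [Fintype β]
    [Nonempty α] [Nonempty β]
    {T : Matrix α β K →ₗ[K] Matrix γ δ K} (hT : Function.Injective T)
    (hl : ∀ a, ∃ p, ∀ b, ∃ y, T (vecMulVec a b) = vecMulVec p y)
    (hr : ∀ b, ∃ q, ∀ a, ∃ x, T (vecMulVec a b) = vecMulVec x q) :
    ∃ (P : Matrix γ α K) (Q : Matrix δ β K), ∀ A, T A = P * A * Qᵀ := by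
  classical
  obtain ⟨i₀⟩ := ‹Nonempty α›
  obtain ⟨j₀⟩ := ‹Nonempty β›
  have hne : ∀ {a b}, a ≠ 0 → b ≠ 0 → T (vecMulVec a b) ≠ 0 := fun ha hb h =>
    vecMulVec_ne_zero_of ha hb (hT (h.trans (map_zero T).symm))
  have nzl : ∀ {x : γ → K} {y : δ → K}, vecMulVec x y ≠ 0 → x ≠ 0 := by
    rintro _ y h rfl; exact h (zero_vecMulVec y)
  have nzr : ∀ {x : γ → K} {y : δ → K}, vecMulVec x y ≠ 0 → y ≠ 0 := by
    rintro x _ h rfl; exact h (by ext; simp [vecMulVec_apply])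
  let a₀ : α → K := Pi.single i₀ 1
  let b₀ : β → K := Pi.single j₀ 1
  have ha₀ : a₀ ≠ 0 := by simp [a₀]
  have hb₀ : b₀ ≠ 0 := by simp [b₀]
  obtain ⟨p₀, hp₀⟩ := hl a₀
  obtain ⟨q₀, hq₀⟩ := hr b₀
  obtain ⟨Q, hQ⟩ := exists_linear_right (F := T ∘ₗ vecMulVecBilin K K a₀) hp₀
  obtain ⟨S, hS⟩ := exists_linear_left (F := T ∘ₗ (vecMulVecBilin K K).flip b₀) hq₀
  replace hQ : ∀ b, T (vecMulVec a₀ b) = vecMulVec p₀ (Q b) := hQ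
  replace hS : ∀ a, T (vecMulVec a b₀) = vecMulVec (S a) q₀ := hS
  have hS0 : ∀ {a}, a ≠ 0 → S a ≠ 0 := fun ha => nzl (hS _ ▸ hne ha hb₀)
  have hQ0 : ∀ {b}, b ≠ 0 → Q b ≠ 0 := fun hb => nzr (hQ _ ▸ hne ha₀ hb)
  have hQi : Function.Injective Q := (injective_iff_map_eq_zero Q).mpr fun b h => by
    by_contra hb; exact hQ0 hb h
  have hSi : Function.Injective S := (injective_iff_map_eq_zero S).mpr fun b h => by
    by_contra hb; exact hS0 hb h
  -- The left factor of T(abᵀ) can be read off at `b₀` and the right factor at `a₀`, so only a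
  -- scalar depending on a and b is undetermined. It is constant in b for fixed a, and constant in a
  -- at `b₀`, hence constant.
  have local_scalar : ∀ a b, ∃ c : K, T (vecMulVec a b) = c • vecMulVec (S a) (Q b) := by
    intro a b
    by_cases ha : a = 0
    · exact ⟨0, by simp [ha]⟩
    by_cases hb : b = 0
    · refine ⟨0, ?_⟩
      have : vecMulVec a b = 0 := by ext; simp [hb, vecMulVec_apply]
      simp [this]
    obtain ⟨p, hp⟩ := hl a
    obtain ⟨q, hq⟩ := hr b
    obtain ⟨y₁, hy₁⟩ := hp b
    obtain ⟨y₂, hy₂⟩ := hp b₀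
    obtain ⟨x₁, hx₁⟩ := hq a
    obtain ⟨x₂, hx₂⟩ := hq a₀
    obtain ⟨c, hc⟩ := eq_smul_of_vecMulVec_eq (hy₂.symm.trans (hS a)) (nzr (hy₂ ▸ hne ha hb₀))
    obtain ⟨d, hd⟩ := eq_smul_of_vecMulVec_eq' (hx₂.symm.trans (hQ b)) (nzl (hx₂ ▸ hne ha₀ hb))
    have e₁ : T (vecMulVec a b) = vecMulVec (S a) (c • y₁) := by
      rw [hy₁, hc, smul_vecMulVec, vecMulVec_smul]
    have e₂ : T (vecMulVec a b) = vecMulVec (d • x₁) (Q b) := by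
      rw [hx₁, hd, smul_vecMulVec, vecMulVec_smul]
    obtain ⟨r, hr⟩ := eq_smul_of_vecMulVec_eq' (e₁.symm.trans e₂) (hS0 ha)
    exact ⟨r, by rw [e₁, hr, vecMulVec_smul]⟩
  have hfa : ∀ a, a ≠ 0 → ∃ c : K, ∀ b, T (vecMulVec a b) = c • vecMulVec (S a) (Q b) :=
    fun a ha => exists_eq_smul_of_forall (F := T ∘ₗ vecMulVecBilin K K a)
      (G := vecMulVecBilin K K (S a) ∘ₗ Q)
      ((vecMulVec_right_injective (hS0 ha)).comp hQi) (local_scalar a)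
  have hfb : ∃ c : K, ∀ a, T (vecMulVec a b₀) = c • vecMulVec (S a) (Q b₀) :=
    exists_eq_smul_of_forall (F := T ∘ₗ (vecMulVecBilin K K).flip b₀)
      (G := (vecMulVecBilin K K).flip (Q b₀) ∘ₗ S)
      ((vecMulVec_left_injective (hQ0 hb₀)).comp hSi) fun a => local_scalar a b₀
  obtain ⟨c, hc⟩ := hfb
  have main : ∀ a b, T (vecMulVec a b) = c • vecMulVec (S a) (Q b) := by
    intro a b
    by_cases ha : a = 0
    · simp [ha]
    obtain ⟨d, hd⟩ := hfa a ha
    have : d • vecMulVec (S a) (Q b₀) = c • vecMulVec (S a) (Q b₀) := by rw [← hd, hc]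
    rw [hd, smul_left_injective K (vecMulVec_ne_zero_of (hS0 ha) (hQ0 hb₀)) this]
  refine ⟨c • LinearMap.toMatrix' S, LinearMap.toMatrix' Q, fun A => ?_⟩
  refine LinearMap.congr_fun (g := (mulRightLinearMap γ K (LinearMap.toMatrix' Q)ᵀ) ∘ₗ
    mulLeftLinearMap β K (c • LinearMap.toMatrix' S)) (linearMap_ext_vecMulVec fun a b => ?_) A
  change _ = (c • LinearMap.toMatrix' S) * vecMulVec a b * (LinearMap.toMatrix' Q)ᵀ
  rw [mul_vecMulVec_mul_transpose, main, smul_mulVec, LinearMap.toMatrix'_mulVec,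
    LinearMap.toMatrix'_mulVec, smul_vecMulVec]

/-- If some `a bᵀ`, with `a` fixed, all have the same left factor, then for every fixed `b`
the right factor is constant. -/
theorem right_factor_of_left_factor {α β γ : Type*} [Finite β] [Nontrivial α] [Nonempty β]
    {T : Matrix α β K →ₗ[K] Matrix γ β K} (hT : Function.Injective T)
    (h1 : ∀ a b, ∃ x y, T (vecMulVec a b) = vecMulVec x y) {a₀ : α → K} (ha₀ : a₀ ≠ 0)
    {p : γ → K} (hp : ∀ b, ∃ y, T (vecMulVec a₀ b) = vecMulVec p y) (b : β → K) :
    ∃ q, ∀ a, ∃ x, T (vecMulVec a b) = vecMulVec x q := by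
  classical
  by_cases hb : b = 0
  · refine ⟨0, fun a => ⟨0, ?_⟩⟩
    have : vecMulVec a b = 0 := by ext; simp [hb, vecMulVec_apply]
    simp [this]
  refine (common_factor (T ∘ₗ (vecMulVecBilin K K).flip b) fun a => h1 a b).resolve_left ?_
  rintro ⟨p', hp'⟩
  replace hp' : ∀ a, ∃ y, T (vecMulVec a b) = vecMulVec p' y := hp'
  obtain ⟨R, hR⟩ := exists_linear_right (F := T ∘ₗ vecMulVecBilin K K a₀) hp
  replace hR : ∀ b, T (vecMulVec a₀ b) = vecMulVec p (R b) := hR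
  have hRi : Function.Injective R := by
    refine (injective_iff_map_eq_zero R).mpr fun b' h => ?_
    by_contra hb'
    refine vecMulVec_ne_zero_of ha₀ hb' (hT ?_)
    rw [hR, h, map_zero]
    ext; simp [vecMulVec_apply]
  -- Right factors in source and target have the same index type, so injectivity suffices.
  have hRs : Function.Surjective R := LinearMap.surjective_of_injective hRi
  obtain ⟨y, hy⟩ := hp' a₀
  have hne : vecMulVec p' y ≠ 0 := fun h =>
    vecMulVec_ne_zero_of ha₀ hb (hT ((hy.trans h).trans (map_zero T).symm))
  obtain ⟨c, hc⟩ := eq_smul_of_vecMulVec_eq (hy.symm.trans (hR b)) (by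
    rintro rfl; exact hne (by ext; simp [vecMulVec_apply]))
  -- With `p'` a multiple of `p`, everything T(abᵀ) can reach is already reached from `a₀`.
  -- Injectivity would then make every a a multiple of `a₀`, which fails in dimension at least two.
  have par : ∀ a, ∃ b', vecMulVec a b = vecMulVec a₀ b' := by
    intro a
    obtain ⟨z, hz⟩ := hp' a
    obtain ⟨b', hb'⟩ := hRs (c • z)
    refine ⟨b', hT ?_⟩
    rw [hz, hR, hb', hc, smul_vecMulVec, vecMulVec_smul]
  obtain ⟨i, j, hij⟩ := exists_pair_ne α
  obtain ⟨b₁, e₁⟩ := par (Pi.single i 1)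
  obtain ⟨b₂, e₂⟩ := par (Pi.single j 1)
  obtain ⟨c₁, f₁⟩ := eq_smul_of_vecMulVec_eq e₁ hb
  obtain ⟨c₂, f₂⟩ := eq_smul_of_vecMulVec_eq e₂ hb
  have g₁ := congrFun f₁ i
  have g₂ := congrFun f₁ j
  have g₃ := congrFun f₂ i
  have g₄ := congrFun f₂ j
  simp [hij, hij.symm] at g₁ g₂ g₃ g₄
  rcases g₂ with h | h
  · simp [h] at g₁
  · simp [h] at g₄

theorem left_factor_of_right_factor {α β δ : Type*} [Finite α] [Nontrivial β] [Nonempty α]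
    {T : Matrix α β K →ₗ[K] Matrix α δ K} (hT : Function.Injective T)
    (h1 : ∀ a b, ∃ x y, T (vecMulVec a b) = vecMulVec x y) {b₀ : β → K} (hb₀ : b₀ ≠ 0)
    {q : δ → K} (hq : ∀ a, ∃ x, T (vecMulVec a b₀) = vecMulVec x q) (a : α → K) :
    ∃ p, ∀ b, ∃ y, T (vecMulVec a b) = vecMulVec p y := by
  let T' : Matrix β α K →ₗ[K] Matrix δ α K := (transposeLinearEquiv α δ K K).toLinearMap ∘ₗ T ∘ₗ
    (transposeLinearEquiv β α K K).toLinearMap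
  have hT' : ∀ A, T' A = (T Aᵀ)ᵀ := fun _ => rfl
  obtain ⟨p', hp'⟩ := right_factor_of_left_factor (T := T')
    (fun A B h => transpose_injective (hT (transpose_injective h)))
    (fun b a => by
      obtain ⟨x, y, h⟩ := h1 a b
      exact ⟨y, x, by rw [hT', transpose_vecMulVec, h, transpose_vecMulVec]⟩) hb₀
    (p := q) (fun a => by
      obtain ⟨x, h⟩ := hq a
      exact ⟨x, by rw [hT', transpose_vecMulVec, h, transpose_vecMulVec]⟩) a
  refine ⟨p', fun b => ?_⟩
  obtain ⟨x, hx⟩ := hp' b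
  refine ⟨x, transpose_injective ?_⟩
  rw [transpose_vecMulVec, ← hx, hT', transpose_vecMulVec]

/-- An injective linear map preserving rank at most one on matrices is either of the form
`A ↦ P A Qᵀ` or of the form `A ↦ P Aᵀ Qᵀ`. -/
theorem rank_one_preserver {α β : Type*} [Fintype α] [Fintype β] [Nontrivial α] [Nontrivial β]
    {T : Matrix α β K →ₗ[K] Matrix α β K} (hT : Function.Injective T)
    (h1 : ∀ a b, ∃ x y, T (vecMulVec a b) = vecMulVec x y) :
    (∃ (P : Matrix α α K) (Q : Matrix β β K), ∀ A, T A = P * A * Qᵀ) ∨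
      ∃ (P : Matrix α β K) (Q : Matrix β α K), ∀ A, T A = P * Aᵀ * Qᵀ := by
  by_cases hex : ∃ a₀ : α → K, a₀ ≠ 0 ∧ ∃ p, ∀ b, ∃ y, T (vecMulVec a₀ b) = vecMulVec p y
  · left
    obtain ⟨a₀, ha₀, p, hp⟩ := hex
    have hr := right_factor_of_left_factor hT h1 ha₀ hp
    refine exists_eq_mul_mul_transpose_of_factors hT (fun a => ?_) hr
    classical
    obtain ⟨j⟩ := (inferInstance : Nonempty β)
    let b₀ : β → K := Pi.single j 1
    have hb₀ : b₀ ≠ 0 := by simp [b₀]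
    obtain ⟨q, hq⟩ := hr b₀
    exact left_factor_of_right_factor hT h1 hb₀ hq a
  -- Now no nonzero a gives a common left factor, so `common_factor` gives a common right factor for
  -- each a. The roles of the factors are exchanged, and T composed with transposition is of the
  -- first kind.
  · right
    push Not at hex
    let T' : Matrix β α K →ₗ[K] Matrix α β K := T ∘ₗ (transposeLinearEquiv β α K K).toLinearMap
    have hT' : ∀ a b, T' (vecMulVec b a) = T (vecMulVec a b) := fun a b =>
      congrArg T (transpose_vecMulVec b a)
    have hr : ∀ a, ∃ q, ∀ b, ∃ x, T (vecMulVec a b) = vecMulVec x q := by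
      intro a
      by_cases ha : a = 0
      · exact ⟨0, fun b => ⟨0, by simp [ha]⟩⟩
      refine (common_factor (T ∘ₗ vecMulVecBilin K K a) fun b => h1 a b).resolve_left ?_
      rintro ⟨p, hp⟩
      obtain ⟨b, hb⟩ := hex a ha p
      obtain ⟨y, hy⟩ := hp b
      exact hb y hy
    have hl : ∀ b, ∃ p, ∀ a, ∃ y, T (vecMulVec a b) = vecMulVec p y := by
      intro b
      by_cases hb : b = 0
      · refine ⟨0, fun a => ⟨0, ?_⟩⟩
        have : vecMulVec a b = 0 := by ext; simp [hb, vecMulVec_apply]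
        simp [this]
      refine (common_factor (T ∘ₗ (vecMulVecBilin K K).flip b) fun a => h1 a b).resolve_right ?_
      rintro ⟨q, hq⟩
      obtain ⟨a, ha⟩ := exists_ne (0 : α → K)
      obtain ⟨p, hp⟩ := left_factor_of_right_factor hT h1 hb hq a
      obtain ⟨b', hb'⟩ := hex a ha p
      obtain ⟨y, hy⟩ := hp b'
      exact hb' y hy
    obtain ⟨P, Q, h⟩ := exists_eq_mul_mul_transpose_of_factors (T := T')
      (hT.comp transpose_injective)
      (fun b => by
        obtain ⟨p, hp⟩ := hl b
        exact ⟨p, fun a => by rw [hT']; exact hp a⟩)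
      (fun a => by
        obtain ⟨q, hq⟩ := hr a
        exact ⟨q, fun b => by rw [hT']; exact hq b⟩)
    exact ⟨P, Q, fun A => h Aᵀ⟩

/-! ### Descent from rank at most k to rank at most one -/

/-- The columns of B are preimages of a basis of the range of A, so AB has independent columns and
admits a left inverse C. -/
theorem exists_mul_mul_eq_one {K α β : Type*} [Field K] [Fintype α] [Fintype β]
    (A : Matrix α β K) :
    ∃ (C : Matrix (Fin A.rank) α K) (B : Matrix β (Fin A.rank) K), C * A * B = 1 := by
  classical
  let e := Module.finBasisOfFinrankEq K (LinearMap.range A.mulVecLin) (n := A.rank) rfl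
  choose b hb using fun i => (e i).2
  let B : Matrix β (Fin A.rank) K := Matrix.of fun j i => b i j
  have hcol : (A * B).col = fun i => (e i : α → K) := by
    ext i p
    rw [← hb]
    rfl
  have hinj : Function.Injective (A * B).mulVec := by
    rw [mulVec_injective_iff, hcol]
    exact e.linearIndependent.map' (Submodule.subtype _) (Submodule.ker_subtype _)
  obtain ⟨h, hh⟩ := LinearMap.exists_leftInverse_of_injective (A * B).mulVecLin
    (LinearMap.ker_eq_bot.mpr hinj)
  refine ⟨LinearMap.toMatrix' h, B, ?_⟩
  rw [Matrix.mul_assoc, ← LinearMap.toMatrix'_toLin' (A * B), toLin'_apply',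
    ← LinearMap.toMatrix'_comp, hh, LinearMap.toMatrix'_id]

theorem matrix_rank_add_le {K α β : Type*} [Field K] [Finite α] [Fintype β] (A B : Matrix α β K) :
    (A + B).rank ≤ A.rank + B.rank := by
  refine le_trans (Submodule.finrank_mono ?_)
    (Submodule.finrank_add_le_finrank_add_finrank (LinearMap.range A.mulVecLin)
      (LinearMap.range B.mulVecLin))
  rw [mulVecLin_add]
  exact LinearMap.range_add_le _ _

theorem exists_mulVec_eq_zero_of_rank_lt {K α β : Type*} [Field K] [Fintype β]
    {A : Matrix α β K} (h : A.rank < Fintype.card β) : ∃ v, v ≠ 0 ∧ A *ᵥ v = 0 := by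
  have h1 := A.mulVecLin.finrank_range_add_finrank_ker
  rw [Module.finrank_fintype_fun_eq_card] at h1
  have h2 : LinearMap.ker A.mulVecLin ≠ ⊥ := by
    intro h0
    rw [h0, finrank_bot] at h1
    exact absurd h1 h.ne
  obtain ⟨v, hv, hv0⟩ := Submodule.exists_mem_ne_zero_of_ne_bot h2
  exact ⟨v, hv0, hv⟩

/-- A direction along which the rank of a matrix of non-maximal rank does not increase is
orthogonal to a fixed nonzero matrix of rank one. -/
theorem exists_normal_of_rank_lt {α β : Type*} [Fintype α] [Fintype β] {A : Matrix α β ℂ}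
    (hα : A.rank < Fintype.card α) (hβ : A.rank < Fintype.card β) :
    ∃ (y : α → ℂ) (v : β → ℂ), y ≠ 0 ∧ v ≠ 0 ∧
      ∀ X : Matrix α β ℂ, (∀ t : ℂ, (A + t • X).rank ≤ A.rank) → y ⬝ᵥ X *ᵥ v = 0 := by
  classical
  obtain ⟨C, B, hCB⟩ := exists_mul_mul_eq_one A
  obtain ⟨v, hv0, hv⟩ := exists_mulVec_eq_zero_of_rank_lt hβ
  obtain ⟨y, hy0, hy⟩ := exists_mulVec_eq_zero_of_rank_lt (A := Aᵀ) (by rwa [rank_transpose])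
  rw [mulVec_transpose] at hy
  refine ⟨y, v, hy0, hv0, fun X hX => ?_⟩
  let Y := replicateRow Unit y
  let V := replicateCol Unit v
  have hYA : Y * A = 0 := by
    rw [← replicateRow_vecMul, hy]; rfl
  have hAV : A * V = 0 := by
    rw [← replicateCol_mulVec, hv]; rfl
  -- Compressing A + tX by the rows (C, y) and the columns (B, v) gives a square matrix of size rank
  -- A + 1, hence singular. `N t` is that matrix with the factor t removed from its last column; its
  -- determinant vanishes for t ≠ 0, so by continuity at 0, where it equals yᵀXv.
  let N : ℂ → Matrix (Fin A.rank ⊕ Unit) (Fin A.rank ⊕ Unit) ℂ := fun t =>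
    fromBlocks (1 + t • (C * X * B)) (C * X * V) (t • (Y * X * B)) (Y * X * V)
  have hN : ∀ t, fromRows C Y * (A + t • X) * fromCols B V =
      N t * fromBlocks 1 0 0 (t • 1) := by
    intro t
    rw [fromRows_mul, fromRows_mul_fromCols, fromBlocks_multiply]
    simp only [Matrix.mul_add, Matrix.add_mul, hYA, hCB, Matrix.mul_assoc C A V, hAV,
      Matrix.mul_zero, zero_add, add_zero, Matrix.mul_one, Matrix.mul_smul,
      Matrix.smul_mul]
  have hdet : ∀ t, t ≠ 0 → (N t).det = 0 := by
    intro t ht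
    have h1 : (fromRows C Y * (A + t • X) * fromCols B V).det = 0 := by
      by_contra h
      have h2 := rank_of_det_ne_zero h
      have h3 := (rank_mul_le_left (fromRows C Y * (A + t • X)) (fromCols B V)).trans
        ((rank_mul_le_right _ _).trans (hX t))
      rw [h2] at h3
      simp at h3
    rw [hN, det_mul, det_fromBlocks_zero₁₂] at h1
    simpa [ht] using h1
  have hcont : Continuous fun t => (N t).det := by
    refine Continuous.matrix_det ?_
    refine Continuous.matrix_fromBlocks ?_ ?_ ?_ ?_ <;> fun_prop
  have hext := hcont.ext_on (dense_compl_singleton (0 : ℂ)) (continuous_const (y := (0 : ℂ)))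
    fun t ht => hdet t ht
  have h0 := congrFun hext 0
  simp only [N, zero_smul, add_zero, det_fromBlocks_zero₂₁, det_one, one_mul, det_unique] at h0
  rw [← h0, Matrix.mul_assoc, ← replicateCol_mulVec]
  rfl

/-- A surjective linear map that does not increase rank beyond `k + 1` does not increase rank
beyond `k`. -/
theorem rank_map_le_of_succ {α β : Type*} [Fintype α] [Fintype β] {k : ℕ}
    (hα : k + 1 < Fintype.card α) (hβ : k + 1 < Fintype.card β)
    {T : Matrix α β ℂ →ₗ[ℂ] Matrix α β ℂ} (hT : Function.Surjective T)
    (h : ∀ A, A.rank ≤ k + 1 → (T A).rank ≤ k + 1) {A : Matrix α β ℂ} (hA : A.rank ≤ k) :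
    (T A).rank ≤ k := by
  classical
  by_contra hlt
  have hr : (T A).rank = k + 1 := le_antisymm (h A (by omega)) (by omega)
  obtain ⟨y, v, hy, hv, hX⟩ := exists_normal_of_rank_lt (A := T A) (by omega) (by omega)
  let φ : Matrix α β ℂ →ₗ[ℂ] ℂ :=
    { toFun Z := y ⬝ᵥ Z *ᵥ v
      map_add' := fun Z Z' => by rw [add_mulVec, dotProduct_add]
      map_smul' := fun c Z => by rw [smul_mulVec, dotProduct_smul]; rfl }
  -- Adding a multiple of a rank-one matrix to A keeps the rank within k + 1, so its image is an
  -- admissible direction at T A. Rank-one matrices span, hence φ kills the range of T, although T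
  -- is onto and φ ≠ 0.
  have h0 : φ ∘ₗ T = 0 := by
    refine linearMap_ext_vecMulVec fun a b => hX _ fun t => ?_
    rw [← map_smul, ← map_add, hr, ← smul_vecMulVec]
    exact h _ ((matrix_rank_add_le _ _).trans (add_le_add hA (rank_vecMulVec_le _ _)))
  obtain ⟨i, hi⟩ := Function.ne_iff.mp hy
  obtain ⟨j, hj⟩ := Function.ne_iff.mp hv
  obtain ⟨Z, hZ⟩ := hT (single i j 1)
  have h1 : φ (T Z) = 0 := LinearMap.congr_fun h0 Z
  rw [hZ] at h1
  change y ⬝ᵥ single i j 1 *ᵥ v = 0 at h1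
  rw [single_mulVec, ← Pi.single, dotProduct_single, one_mul] at h1
  exact mul_ne_zero hi hj h1

theorem rank_map_le_one {α β : Type*} [Fintype α] [Fintype β]
    {T : Matrix α β ℂ →ₗ[ℂ] Matrix α β ℂ} (hT : Function.Surjective T) {k : ℕ} (hk : 1 ≤ k)
    (hα : k < Fintype.card α) (hβ : k < Fintype.card β)
    (h : ∀ A, A.rank ≤ k → (T A).rank ≤ k) {A : Matrix α β ℂ} (hA : A.rank ≤ 1) :
    (T A).rank ≤ 1 := by
  induction k, hk using Nat.le_induction with
  | base => exact h A hA
  | succ k hk ih =>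
    exact ih (by omega) (by omega) fun A hA => rank_map_le_of_succ hα hβ hT h hA

/-- A linear bijection that preserves the set of matrices of rank at most `k`, where `k` is less
than both dimensions, is of the form `A ↦ P A Qᵀ` or of the form `A ↦ P Aᵀ Qᵀ`. -/
theorem rank_le_preserver {α β : Type*} [Fintype α] [Fintype β]
    {T : Matrix α β ℂ →ₗ[ℂ] Matrix α β ℂ} (hT : Function.Injective T) {k : ℕ} (hk : 1 ≤ k)
    (hα : k < Fintype.card α) (hβ : k < Fintype.card β)
    (h : ∀ A, A.rank ≤ k → (T A).rank ≤ k) :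
    (∃ (P : Matrix α α ℂ) (Q : Matrix β β ℂ), ∀ A, T A = P * A * Qᵀ) ∨
      ∃ (P : Matrix α β ℂ) (Q : Matrix β α ℂ), ∀ A, T A = P * Aᵀ * Qᵀ := by
  have : Nontrivial α := Fintype.one_lt_card_iff_nontrivial.mp (by omega)
  have : Nontrivial β := Fintype.one_lt_card_iff_nontrivial.mp (by omega)
  exact rank_one_preserver hT fun a b => exists_eq_vecMulVec_of_rank_le_one
    (rank_map_le_one (LinearMap.surjective_of_injective hT) hk hα hβ h (rank_vecMulVec_le a b))

/-! ### Reduction to a single Kraus operator -/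

theorem mul_vecMulVec_star_mul {κ ι : Type*} [Fintype κ] (L : Matrix ι κ ℂ) (w : κ → ℂ) :
    L * vecMulVec w (star w) * Lᴴ = vecMulVec (L *ᵥ w) (star (L *ᵥ w)) := by
  rw [mul_vecMulVec, vecMulVec_mul, star_mulVec]

theorem vecMulVec_star_eq_zero {κ : Type*} {w : κ → ℂ} (h : vecMulVec w (star w) = 0) : w = 0 := by
  by_contra hw
  exact vecMulVec_ne_zero_of hw (star_ne_zero.mpr hw) h

/-- The linear map sending `w` to the matrix with columns `K s w`. -/
def krausMap {κ ι S : Type*} [Fintype κ] (K : S → Matrix ι κ ℂ) : (κ → ℂ) →ₗ[ℂ] Matrix ι S ℂ where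
  toFun w := Matrix.of fun p s => (K s *ᵥ w) p
  map_add' w w' := by
    ext p s
    simp [mulVec_add]
  map_smul' c w := by
    ext p s
    simp [mulVec_smul]

theorem krausMap_mul_conjTranspose {κ ι S : Type*} [Fintype κ] [Fintype S] (K : S → Matrix ι κ ℂ)
    (w : κ → ℂ) :
    krausMap K w * (krausMap K w)ᴴ = ∑ s, K s * vecMulVec w (star w) * (K s)ᴴ := by
  simp_rw [mul_vecMulVec_star_mul]
  ext p q
  simp [krausMap, Matrix.mul_apply, Matrix.sum_apply, vecMulVec_apply]

/-- An injective map cannot send the projections of a two-dimensional space of vectors to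
multiples of a single operator, so the Kraus vectors have a common coefficient vector. -/
theorem common_right_factor {V κ ι S : Type*} [AddCommGroup V] [Module ℂ V] [Fintype S]
    {Φ : Matrix κ κ ℂ →ₗ[ℂ] Matrix ι ι ℂ} (hΦ : Function.Injective Φ)
    {F : (κ → ℂ) →ₗ[ℂ] Matrix ι S ℂ} (hF : ∀ w, Φ (vecMulVec w (star w)) = F w * (F w)ᴴ)
    (g : V →ₗ[ℂ] κ → ℂ) (h1 : ∀ v, ∃ u x, F (g v) = vecMulVec u x)
    {v₁ v₂ : V} {p : κ} (hv₁ : g v₁ p ≠ 0) (hv₂ : g v₂ p = 0) (hv₂' : g v₂ ≠ 0) :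
    ∃ x, ∀ v, ∃ u, F (g v) = vecMulVec u x := by
  refine (common_factor (F ∘ₗ g) h1).resolve_left ?_
  rintro ⟨u, hu⟩
  have h : ∀ v, ∃ r : ℂ, Φ (vecMulVec (g v) (star (g v))) = r • vecMulVec u (star u) := by
    intro v
    obtain ⟨x, hx⟩ := hu v
    replace hx : F (g v) = vecMulVec u x := hx
    refine ⟨x ⬝ᵥ star x, ?_⟩
    rw [hF, hx, conjTranspose_vecMulVec, vecMulVec_mul_vecMulVec, vecMulVec_smul]
  obtain ⟨r₁, h₁⟩ := h v₁
  obtain ⟨r₂, h₂⟩ := h v₂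
  have e : r₂ • vecMulVec (g v₁) (star (g v₁)) = r₁ • vecMulVec (g v₂) (star (g v₂)) := by
    apply hΦ
    rw [map_smul, map_smul, h₁, h₂, smul_comm]
  -- The (p, p) entry isolates `r₂`, since `g v₂` vanishes at p and `g v₁` does not; thus `r₂ = 0`.
  have e' := congrFun (congrFun e p) p
  simp [vecMulVec_apply, hv₂, hv₁] at e'
  rw [e', zero_smul] at h₂
  exact hv₂' (vecMulVec_star_eq_zero (hΦ (h₂.trans (map_zero Φ).symm)))

/-- The vector `a ⊗ b`, as a bilinear map. -/
def tensorVec (α β : Type*) : (α → ℂ) →ₗ[ℂ] (β → ℂ) →ₗ[ℂ] (α × β → ℂ) :=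
  LinearMap.mk₂ ℂ (fun a b p => a p.1 * b p.2)
    (fun a a' b => by ext; simp [add_mul]) (fun c a b => by ext; simp [mul_assoc])
    (fun a b b' => by ext; simp [mul_add]) (fun c a b => by ext; simp [mul_left_comm])

@[simp]
theorem tensorVec_apply {α β : Type*} (a : α → ℂ) (b : β → ℂ) (p : α × β) :
    tensorVec α β a b p = a p.1 * b p.2 := rfl

theorem tensorVec_ne_zero {α β : Type*} {a : α → ℂ} {b : β → ℂ} (ha : a ≠ 0) (hb : b ≠ 0) :
    tensorVec α β a b ≠ 0 := by
  obtain ⟨i, hi⟩ := Function.ne_iff.mp ha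
  obtain ⟨j, hj⟩ := Function.ne_iff.mp hb
  exact Function.ne_iff.mpr ⟨(i, j), mul_ne_zero hi hj⟩

theorem linearMap_ext_tensorVec {V α β : Type*} [AddCommGroup V] [Module ℂ V] [Finite α] [Finite β]
    {F G : (α × β → ℂ) →ₗ[ℂ] V} (h : ∀ a b, F (tensorVec α β a b) = G (tensorVec α β a b)) :
    F = G := by
  classical
  refine LinearMap.pi_ext' fun p => ?_
  ext
  have : tensorVec α β (Pi.single p.1 1) (Pi.single p.2 1) = Pi.single p 1 := by
    ext q
    simp only [tensorVec_apply, Pi.single_apply, Prod.ext_iff, mul_ite, mul_one, mul_zero, ite_and]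
    split_ifs <;> rfl
  simpa [this] using h (Pi.single p.1 1) (Pi.single p.2 1)

/-- An injective completely positive map that sends product states to operators of rank at most
one has a single Kraus operator. -/
theorem exists_eq_conj_of_rank_le_one {α β ι : Type*} [Fintype α] [Fintype β] [Fintype ι]
    [DecidableEq α] [DecidableEq β] [DecidableEq ι] [Nontrivial α] [Nontrivial β]
    (Φ : Matrix (α × β) (α × β) ℂ →CP Matrix ι ι ℂ) (hΦ : Function.Injective Φ)
    (h : ∀ a b, (Φ (vecMulVec (tensorVec α β a b) (star (tensorVec α β a b)))).rank ≤ 1) :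
    ∃ L : Matrix ι (α × β) ℂ, ∀ X, Φ X = L * X * Lᴴ := by
  obtain ⟨K, hK⟩ := exists_kraus Φ
  let F := krausMap K
  have hF : ∀ w, Φ (vecMulVec w (star w)) = F w * (F w)ᴴ := fun w => by
    rw [hK, krausMap_mul_conjTranspose]
  have hF0 : ∀ w, F w = 0 → w = 0 := fun w hw => by
    refine vecMulVec_star_eq_zero (hΦ ?_)
    rw [hF, hw, Matrix.zero_mul]
    exact (map_zero Φ.toLinearMap).symm
  have h1 : ∀ a b, ∃ u x, F (tensorVec α β a b) = vecMulVec u x := fun a b => by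
    refine exists_eq_vecMulVec_of_rank_le_one ?_
    have hr : (F (tensorVec α β a b) * (F (tensorVec α β a b))ᴴ).rank =
        (F (tensorVec α β a b)).rank := by
      open scoped ComplexOrder in exact rank_self_mul_conjTranspose _
    rw [← hr, ← hF]
    exact h a b
  have hl : ∀ a, a ≠ 0 → ∃ x, ∀ b, ∃ u, F (tensorVec α β a b) = vecMulVec u x := by
    intro a ha
    obtain ⟨i, hi⟩ := Function.ne_iff.mp ha
    obtain ⟨j, j', hj⟩ := exists_pair_ne β
    refine common_right_factor (Φ := Φ.toLinearMap) hΦ hF (tensorVec α β a) (h1 a)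
      (v₁ := Pi.single j 1) (v₂ := Pi.single j' 1) (p := (i, j)) (by simpa using hi)
      (by simp [hj]) (tensorVec_ne_zero ha (by simp))
  obtain ⟨j₀⟩ := (inferInstance : Nonempty β)
  let b₀ : β → ℂ := Pi.single j₀ 1
  have hb₀ : b₀ ≠ 0 := by simp [b₀]
  obtain ⟨x, hx⟩ : ∃ x, ∀ a, ∃ u, F (tensorVec α β a b₀) = vecMulVec u x := by
    obtain ⟨i, i', hi⟩ := exists_pair_ne α
    exact common_right_factor (Φ := Φ.toLinearMap) hΦ hF ((tensorVec α β).flip b₀)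
      (fun a => h1 a b₀)
      (v₁ := Pi.single i 1) (v₂ := Pi.single i' 1) (p := (i, j₀)) (by simp [b₀])
      (by simp [hi]) (tensorVec_ne_zero (by simp) hb₀)
  -- The right factor attached to a is compared with `x` at `b₀`, where F is nonzero, so a single
  -- `x` serves all product vectors.
  have hall : ∀ a b, ∃ u, F (tensorVec α β a b) = vecMulVec u x := by
    intro a b
    by_cases ha : a = 0
    · exact ⟨0, by simp [ha]⟩
    obtain ⟨x', hx'⟩ := hl a ha
    obtain ⟨u₀, hu₀⟩ := hx' b₀
    obtain ⟨u₁, hu₁⟩ := hx a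
    obtain ⟨u, hu⟩ := hx' b
    have hne : u₀ ≠ 0 := by
      rintro rfl
      exact tensorVec_ne_zero ha hb₀ (hF0 _ (hu₀.trans (zero_vecMulVec _)))
    obtain ⟨c, rfl⟩ := eq_smul_of_vecMulVec_eq' (hu₀.symm.trans hu₁) hne
    exact ⟨c • u, by rw [hu, vecMulVec_smul, smul_vecMulVec]⟩
  have hx0 : x ≠ 0 := by
    rintro rfl
    obtain ⟨a, ha⟩ := exists_ne (0 : α → ℂ)
    obtain ⟨u, hu⟩ := hx a
    exact tensorVec_ne_zero ha hb₀ (hF0 _ (hu.trans (by ext; simp [vecMulVec_apply])))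
  obtain ⟨s₀, hs₀⟩ := Function.ne_iff.mp hx0
  simp only [Pi.zero_apply] at hs₀
  have hprop : ∀ s, K s = (x s / x s₀) • K s₀ := by
    intro s
    refine toLin'.injective (linearMap_ext_tensorVec fun a b => ?_)
    obtain ⟨u, hu⟩ := hall a b
    ext p
    have e₁ : (K s *ᵥ tensorVec α β a b) p = u p * x s := congrFun (congrFun hu p) s
    have e₂ : (K s₀ *ᵥ tensorVec α β a b) p = u p * x s₀ := congrFun (congrFun hu p) s₀
    rw [toLin'_apply, toLin'_apply, smul_mulVec, Pi.smul_apply, e₁, e₂, smul_eq_mul]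
    field_simp
  -- Proportional Kraus operators contribute the squared moduli of their ratios, so √r · K_{s₀}
  -- replaces them all.
  let r : ℝ := ∑ s, ‖x s / x s₀‖ ^ 2
  have hr : 0 ≤ r := Finset.sum_nonneg fun _ _ => sq_nonneg _
  refine ⟨(Real.sqrt r : ℂ) • K s₀, fun X => ?_⟩
  have hs : ∀ s, K s * X * (K s)ᴴ = ((‖x s / x s₀‖ ^ 2 : ℝ) : ℂ) • (K s₀ * X * (K s₀)ᴴ) := by
    intro s
    rw [hprop s, conjTranspose_smul, Matrix.smul_mul, Matrix.smul_mul, Matrix.mul_smul, smul_smul]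
    congr 1
    push_cast
    exact Complex.mul_conj' _
  rw [hK, Finset.sum_congr rfl fun s _ => hs s, ← Finset.sum_smul,
    conjTranspose_smul, Matrix.smul_mul, Matrix.smul_mul, Matrix.mul_smul, smul_smul]
  congr 1
  rw [← Complex.ofReal_sum, Complex.star_def, Complex.conj_ofReal, ← Complex.ofReal_mul,
    Real.mul_self_sqrt hr]

/-! ### Vectors as matrices, local operators and the swap -/

theorem ketbra_eq {m n : ℕ} (w : EuclideanSpace ℂ (Fin m × Fin n)) :
    ketbra w = vecMulVec (w : Fin m × Fin n → ℂ) (star (w : Fin m × Fin n → ℂ)) := rfl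

/-- The matrix with entries `w (i, j)`, as a linear equivalence. -/
def unvec (α β : Type*) : (α × β → ℂ) ≃ₗ[ℂ] Matrix α β ℂ :=
  LinearEquiv.curry ℂ ℂ α β

theorem unvec_apply {α β : Type*} (w : α × β → ℂ) (i : α) (j : β) : unvec α β w i j = w (i, j) :=
  rfl

theorem unvec_symm_apply {α β : Type*} (A : Matrix α β ℂ) (p : α × β) :
    (unvec α β).symm A p = A p.1 p.2 := rfl

theorem rank_smul_le {K α β : Type*} [Field K] [Fintype β] (c : K) (A : Matrix α β K) :
    (c • A).rank ≤ A.rank := by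
  classical
  have : c • A = A * (c • (1 : Matrix β β K)) := by simp
  rw [this]
  exact rank_mul_le_left _ _

theorem smul_vecMulVec_mem_stateMultiples {m n k : ℕ} (c : ℝ) {w : Fin m × Fin n → ℂ} (hw : w ≠ 0)
    (hr : (unvec (Fin m) (Fin n) w).rank ≤ k) :
    (c : ℂ) • vecMulVec w (star w) ∈ stateMultiples m n k := by
  let v : EuclideanSpace ℂ (Fin m × Fin n) := WithLp.toLp 2 w
  have hv : ‖v‖ ≠ 0 := by
    rw [norm_ne_zero_iff]
    exact fun h => hw (congrArg WithLp.ofLp h)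
  -- Normalizing the vector moves the factor ‖v‖² into the real coefficient.
  refine ⟨c * ‖v‖ ^ 2, ((‖v‖⁻¹ : ℝ) : ℂ) • v, ?_, ?_, ?_⟩
  · rw [norm_smul, Complex.norm_real, norm_inv, norm_norm, inv_mul_cancel₀ hv]
  · exact (rank_smul_le ((‖v‖⁻¹ : ℝ) : ℂ) (unvec _ _ w)).trans hr
  · rw [ketbra_eq]
    change _ = _ • vecMulVec (((‖v‖⁻¹ : ℝ) : ℂ) • w) (star (((‖v‖⁻¹ : ℝ) : ℂ) • w))
    rw [star_smul, smul_vecMulVec, vecMulVec_smul, smul_smul, smul_smul, Complex.star_def,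
      Complex.conj_ofReal]
    congr 1
    norm_cast
    field_simp

theorem exists_of_mem_stateMultiples {m n k : ℕ} {X : Op m n} (h : X ∈ stateMultiples m n k) :
    ∃ (c : ℂ) (w : Fin m × Fin n → ℂ), (unvec (Fin m) (Fin n) w).rank ≤ k ∧
      X = c • vecMulVec w (star w) := by
  obtain ⟨c, w, -, hr, rfl⟩ := h
  exact ⟨c, w, hr, rfl⟩

theorem kronecker_mulVec_apply {α β : Type*} [Fintype α] [Fintype β] (P : Matrix α α ℂ)
    (Q : Matrix β β ℂ) (w : α × β → ℂ) :
    unvec α β ((P ⊗ₖ Q) *ᵥ w) = P * unvec α β w * Qᵀ := by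
  ext i j
  simp only [unvec_apply, mulVec, dotProduct, kroneckerMap_apply, Matrix.mul_apply, transpose_apply,
    Fintype.sum_prod_type, Finset.sum_mul]
  rw [Finset.sum_comm]
  refine Finset.sum_congr rfl fun b _ => Finset.sum_congr rfl fun a _ => ?_
  ring

theorem swapOp_mul_apply {n : ℕ} (M : Op n n) (p q : Fin n × Fin n) :
    (swapOp rfl * M : Op n n) p q = M (p.2, p.1) q := by
  rw [Matrix.mul_apply, Finset.sum_eq_single (p.2, p.1)]
  · simp [swapOp]
  · rintro ⟨i, j⟩ - h
    have : ¬(p.1 = j ∧ p.2 = i) := by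
      rintro ⟨rfl, rfl⟩
      exact h rfl
    simp [swapOp, this]
  · simp

theorem swapOp_mul_mulVec {n : ℕ} (M : Op n n) (w : Fin n × Fin n → ℂ) :
    unvec (Fin n) (Fin n) ((swapOp rfl * M) *ᵥ w) = (unvec (Fin n) (Fin n) (M *ᵥ w))ᵀ := by
  ext i j
  simp [unvec_apply, mulVec, dotProduct, swapOp_mul_apply]

theorem swapOp_conjTranspose_mul {n : ℕ} : (swapOp (rfl : n = n))ᴴ * swapOp rfl = 1 := by
  have h : (swapOp (rfl : n = n))ᴴ = swapOp rfl := by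
    ext p q
    simp only [conjTranspose_apply, swapOp, of_apply, Fin.cast_eq_self]
    by_cases h : q.1 = p.2 ∧ q.2 = p.1
    · simp [h]
    · have : ¬(p.1 = q.2 ∧ p.2 = q.1) := fun h' => h ⟨h'.2.symm, h'.1.symm⟩
      rw [if_neg h, if_neg this, star_zero]
  rw [h]
  ext p q
  rw [swapOp_mul_apply]
  simp only [swapOp, of_apply, Fin.cast_eq_self, one_apply, Prod.ext_iff]
  congr 1
  exact propext and_comm

theorem isUnit_swapOp {n : ℕ} : IsUnit (swapOp (rfl : n = n)) :=
  IsUnit.of_mul_eq_one_right _ swapOp_conjTranspose_mul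

theorem isUnit_kronecker_iff {α β : Type*} [Fintype α] [Fintype β] [DecidableEq α] [DecidableEq β]
    [Nonempty α] [Nonempty β] {P : Matrix α α ℂ} {Q : Matrix β β ℂ} :
    IsUnit (P ⊗ₖ Q) ↔ IsUnit P ∧ IsUnit Q := by
  simp only [isUnit_iff_isUnit_det, det_kronecker, isUnit_iff_ne_zero, mul_ne_zero_iff, ne_eq,
    pow_eq_zero_iff Fintype.card_ne_zero]

theorem IsLocalNonsingular.isUnit {m n : ℕ} [NeZero m] [NeZero n] {L : Op m n}
    (h : IsLocalNonsingular L) : IsUnit L := by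
  rcases h with ⟨P, Q, hP, hQ, rfl⟩ | ⟨rfl, P, Q, hP, hQ, rfl⟩
  · exact isUnit_kronecker_iff.mpr ⟨hP, hQ⟩
  · exact isUnit_swapOp.mul (isUnit_kronecker_iff.mpr ⟨hP, hQ⟩)

theorem IsLocalNonsingular.rank_unvec_mulVec_le {m n : ℕ} {L : Op m n} (h : IsLocalNonsingular L)
    (w : Fin m × Fin n → ℂ) : (unvec _ _ (L *ᵥ w)).rank ≤ (unvec _ _ w).rank := by
  have key : ∀ (P : Matrix (Fin m) (Fin m) ℂ) (Q : Matrix (Fin n) (Fin n) ℂ),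
      (unvec _ _ ((P ⊗ₖ Q) *ᵥ w)).rank ≤ (unvec _ _ w).rank := fun P Q => by
    rw [kronecker_mulVec_apply]
    exact (rank_mul_le_left _ _).trans (rank_mul_le_right _ _)
  rcases h with ⟨P, Q, -, -, rfl⟩ | ⟨rfl, P, Q, -, -, rfl⟩
  · exact key P Q
  · rw [swapOp_mul_mulVec, rank_transpose]
    exact key P Q

theorem IsLocalNonsingular.mapsTo {m n k : ℕ} [NeZero m] [NeZero n] {L : Op m n}
    (h : IsLocalNonsingular L) :
    Set.MapsTo (fun X => L * X * Lᴴ) (stateMultiples m n k) (stateMultiples m n k) := by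
  rintro _ ⟨c, w, hw, hr, rfl⟩
  rw [ketbra_eq]
  dsimp only
  rw [Matrix.mul_smul, Matrix.smul_mul, mul_vecMulVec_star_mul]
  refine smul_vecMulVec_mem_stateMultiples c ?_ ((h.rank_unvec_mulVec_le _).trans hr)
  intro h0
  have : (w : Fin m × Fin n → ℂ) = 0 :=
    mulVec_injective_of_isUnit h.isUnit (h0.trans (mulVec_zero L).symm)
  have : w = 0 := by
    ext p
    exact congrFun this p
  simp [this] at hw

/-! ### Operators preserving Schmidt rank at most k are local -/

/-- The map of matrices induced by an operator on bipartite vectors. -/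
def opMap {α β : Type*} [Fintype α] [Fintype β] (L : Matrix (α × β) (α × β) ℂ) :
    Matrix α β ℂ →ₗ[ℂ] Matrix α β ℂ :=
  (unvec α β).toLinearMap ∘ₗ L.mulVecLin ∘ₗ (unvec α β).symm.toLinearMap

theorem opMap_single {α β : Type*} [Fintype α] [Fintype β] [DecidableEq α] [DecidableEq β]
    (L : Matrix (α × β) (α × β) ℂ) (p q : α × β) :
    opMap L (single q.1 q.2 1) p.1 p.2 = L p q := by
  have : (unvec α β).symm (single q.1 q.2 1) = Pi.single q 1 := by
    ext r
    simp only [unvec_symm_apply, single_apply, Pi.single_apply, Prod.ext_iff, eq_comm]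
  change (L *ᵥ (unvec α β).symm (single q.1 q.2 1)) p = _
  rw [this, mulVec_single_one]
  rfl

theorem isLocalNonsingular_of_rank_le {m n k : ℕ} (hk : 1 ≤ k) (hm : k < m) (hn : k < n)
    {L : Op m n} (hL : IsUnit L)
    (h : ∀ w, (unvec _ _ w).rank ≤ k → (unvec _ _ (L *ᵥ w)).rank ≤ k) : IsLocalNonsingular L := by
  have hT : Function.Injective (opMap L) :=
    (unvec _ _).injective.comp ((mulVec_injective_of_isUnit hL).comp (unvec _ _).symm.injective)
  have : NeZero m := ⟨by omega⟩
  have : NeZero n := ⟨by omega⟩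
  rcases rank_le_preserver hT hk (by simpa) (by simpa) fun A hA => h ((unvec _ _).symm A) hA with
    ⟨P, Q, hPQ⟩ | ⟨P, Q, hPQ⟩
  · have e : L = P ⊗ₖ Q := by
      ext p q
      rw [← opMap_single L p q, hPQ, single_eq_single_vecMulVec_single, mul_vecMulVec_mul_transpose]
      simp [vecMulVec_apply]
    rw [e] at hL
    exact Or.inl ⟨P, Q, (isUnit_kronecker_iff.mp hL).1, (isUnit_kronecker_iff.mp hL).2, e⟩
  · have hv : ∀ a b, opMap L (vecMulVec a b) = vecMulVec (P *ᵥ b) (Q *ᵥ a) := fun a b => by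
      rw [hPQ, transpose_vecMulVec, mul_vecMulVec_mul_transpose]
    have hP : ∀ b, P *ᵥ b = 0 → b = 0 := by
      intro b hb
      by_contra hb0
      have : (Pi.single 0 1 : Fin m → ℂ) ≠ 0 := by simp
      refine vecMulVec_ne_zero_of this hb0 (hT ?_)
      rw [hv, hb, zero_vecMulVec, map_zero]
    have hQ : ∀ a, Q *ᵥ a = 0 → a = 0 := by
      intro a ha
      by_contra ha0
      have : (Pi.single 0 1 : Fin n → ℂ) ≠ 0 := by simp
      refine vecMulVec_ne_zero_of ha0 this (hT ?_)
      rw [hv, ha, map_zero]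
      ext; simp [vecMulVec_apply]
    -- P and Q are injective between ℂ^n and ℂ^m in opposite directions.
    have hmn : m = n := by
      refine le_antisymm ?_ ?_
      · simpa using LinearMap.finrank_le_finrank_of_injective
          ((injective_iff_map_eq_zero Q.mulVecLin).mpr hQ)
      · simpa using LinearMap.finrank_le_finrank_of_injective
          ((injective_iff_map_eq_zero P.mulVecLin).mpr hP)
    subst hmn
    -- L sends a ⊗ b to Pb ⊗ Qa = S(Qa ⊗ Pb), hence the order of the factors.
    have e : L = swapOp rfl * (Q ⊗ₖ P) := by
      ext p q
      rw [← opMap_single L p q, single_eq_single_vecMulVec_single, hv, swapOp_mul_apply]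
      simp [vecMulVec_apply, mul_comm]
    have hu : IsUnit (Q ⊗ₖ P) := by
      rw [e] at hL
      exact (isUnit_swapOp.mul_left_iff).mp hL
    exact Or.inr ⟨rfl, Q, P, (isUnit_kronecker_iff.mp hu).1, (isUnit_kronecker_iff.mp hu).2, e⟩

/-! ### Unitarity and trace preservation -/

/-- A unitary Kronecker product is the Kronecker product of two unitaries. -/
theorem exists_unitary_kronecker {α β : Type*} [Fintype α] [Fintype β] [DecidableEq α]
    [DecidableEq β] [Nonempty α] [Nonempty β] {P : Matrix α α ℂ} {Q : Matrix β β ℂ}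
    (h : P ⊗ₖ Q ∈ unitaryGroup (α × β) ℂ) :
    ∃ W ∈ unitaryGroup α ℂ, ∃ Y ∈ unitaryGroup β ℂ, P ⊗ₖ Q = W ⊗ₖ Y := by
  obtain ⟨i₀⟩ := ‹Nonempty α›
  obtain ⟨j₀⟩ := ‹Nonempty β›
  have h1 : (Pᴴ * P) ⊗ₖ (Qᴴ * Q) = 1 := by
    rw [mul_kronecker_mul, ← conjTranspose_kronecker]
    exact mem_unitaryGroup_iff'.mp h
  have he : ∀ i i' j j', (Pᴴ * P) i i' * (Qᴴ * Q) j j' =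
      if i = i' ∧ j = j' then 1 else 0 := fun i i' j j' => by
    simpa [one_apply] using congrFun (congrFun h1 (i, j)) (i', j')
  -- From P*P ⊗ Q*Q = 1 it follows that c P*P = 1 and Q*Q = c, so √c P and Q/√c are unitary.
  obtain ⟨c, hc0, hc⟩ : ∃ c : ℝ, 0 ≤ c ∧ (Qᴴ * Q) j₀ j₀ = c := by
    refine ⟨∑ j, ‖Q j j₀‖ ^ 2, Finset.sum_nonneg fun _ _ => sq_nonneg _, ?_⟩
    rw [Matrix.mul_apply]
    push_cast
    exact Finset.sum_congr rfl fun j _ => by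
      rw [conjTranspose_apply, Complex.star_def, Complex.conj_mul']
  have hne : (c : ℂ) ≠ 0 := by
    intro h0
    have := he i₀ i₀ j₀ j₀
    rw [hc, h0] at this
    simp at this
  have hP : (c : ℂ) • (Pᴴ * P) = 1 := by
    ext i i'
    have := he i i' j₀ j₀
    rw [hc] at this
    simpa [one_apply, mul_comm] using this
  have hQ : Qᴴ * Q = (c : ℂ) • 1 := by
    ext j j'
    have h2 := he i₀ i₀ j j'
    have h3 := he i₀ i₀ j₀ j₀
    rw [hc] at h3
    simp only [true_and, and_self, if_true] at h2 h3
    rw [Matrix.smul_apply, one_apply, ← h2, smul_eq_mul]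
    linear_combination (-(Qᴴ * Q) j j') * h3
  have hs : ((Real.sqrt c : ℝ) : ℂ) * (Real.sqrt c : ℝ) = c := by
    rw [← Complex.ofReal_mul, Real.mul_self_sqrt hc0]
  have hs0 : ((Real.sqrt c : ℝ) : ℂ) ≠ 0 := by
    intro h0
    rw [h0, zero_mul] at hs
    exact hne hs.symm
  refine ⟨((Real.sqrt c : ℝ) : ℂ) • P, ?_, ((Real.sqrt c : ℝ) : ℂ)⁻¹ • Q, ?_, ?_⟩
  · rw [mem_unitaryGroup_iff', star_eq_conjTranspose, conjTranspose_smul, Matrix.smul_mul,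
      Matrix.mul_smul, smul_smul, Complex.star_def, Complex.conj_ofReal, hs, hP]
  · rw [mem_unitaryGroup_iff', star_eq_conjTranspose, conjTranspose_smul, Matrix.smul_mul,
      Matrix.mul_smul, smul_smul, Complex.star_def, ← Complex.ofReal_inv, Complex.conj_ofReal,
      hQ, smul_smul, ← hs, Complex.ofReal_inv]
    have : (((Real.sqrt c : ℝ) : ℂ)⁻¹ * ((Real.sqrt c : ℝ) : ℂ)⁻¹ *
        (((Real.sqrt c : ℝ) : ℂ) * ((Real.sqrt c : ℝ) : ℂ))) = 1 := by
      field_simp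
    rw [this, one_smul]
  · rw [smul_kronecker, kronecker_smul, smul_smul, mul_inv_cancel₀ hs0, one_smul]

theorem IsLocalNonsingular.isLocalUnitary {m n : ℕ} [NeZero m] [NeZero n] {L : Op m n}
    (h : IsLocalNonsingular L) (hL : L ∈ unitaryGroup (Fin m × Fin n) ℂ) : IsLocalUnitary L := by
  rcases h with ⟨P, Q, -, -, rfl⟩ | ⟨rfl, P, Q, -, -, rfl⟩
  · obtain ⟨W, hW, Y, hY, e⟩ := exists_unitary_kronecker hL
    exact Or.inl ⟨W, Y, hW, hY, e⟩
  · have hPQ : P ⊗ₖ Q ∈ unitaryGroup (Fin m × Fin m) ℂ := by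
      rw [mem_unitaryGroup_iff', star_eq_conjTranspose] at hL ⊢
      rwa [conjTranspose_mul, Matrix.mul_assoc, ← Matrix.mul_assoc _ (swapOp rfl),
        swapOp_conjTranspose_mul, Matrix.one_mul] at hL
    obtain ⟨W, hW, Y, hY, e⟩ := exists_unitary_kronecker hPQ
    exact Or.inr ⟨rfl, W, Y, hW, hY, by rw [e]⟩

theorem isUnit_of_mem_unitaryGroup {α : Type*} [Fintype α] [DecidableEq α] {U : Matrix α α ℂ}
    (h : U ∈ unitaryGroup α ℂ) : IsUnit U :=
  IsUnit.of_mul_eq_one _ (mem_unitaryGroup_iff.mp h)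

theorem IsLocalUnitary.isLocalNonsingular {m n : ℕ} {L : Op m n} (h : IsLocalUnitary L) :
    IsLocalNonsingular L := by
  rcases h with ⟨W, Y, hW, hY, e⟩ | ⟨h, W, Y, hW, hY, e⟩
  · exact Or.inl ⟨W, Y, isUnit_of_mem_unitaryGroup hW, isUnit_of_mem_unitaryGroup hY, e⟩
  · exact Or.inr ⟨h, W, Y, isUnit_of_mem_unitaryGroup hW, isUnit_of_mem_unitaryGroup hY, e⟩

/-- Cyclicity turns the hypothesis into Tr(L*L X) = Tr(X) for all X, and the trace pairing is
nondegenerate. -/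
theorem mem_unitaryGroup_of_trace {α : Type*} [Fintype α] [DecidableEq α] {L : Matrix α α ℂ}
    (h : ∀ X, (L * X * Lᴴ).trace = X.trace) : L ∈ unitaryGroup α ℂ := by
  rw [mem_unitaryGroup_iff', star_eq_conjTranspose]
  refine ext_iff_trace_mul_right.mpr fun X => ?_
  rw [Matrix.one_mul, ← h X, Matrix.mul_assoc, trace_mul_comm]

/-! ### Assembly of the characterization -/

/-- A completely positive bijection mapping `stateMultiples` into itself is conjugation by a local
operator. -/
theorem exists_isLocalNonsingular {m n k : ℕ} (hk : 1 ≤ k) (hm : k < m) (hn : k < n)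
    (Φ : Op m n →CP Op m n) (hΦ : Function.Injective Φ)
    (h : Set.MapsTo Φ (stateMultiples m n k) (stateMultiples m n k)) :
    ∃ L : Op m n, IsUnit L ∧ IsLocalNonsingular L ∧ ∀ X, Φ X = L * X * Lᴴ := by
  have : Nontrivial (Fin m) := Fin.nontrivial_iff_two_le.mpr (by omega)
  have : Nontrivial (Fin n) := Fin.nontrivial_iff_two_le.mpr (by omega)
  have hmap : ∀ w : Fin m × Fin n → ℂ, (unvec _ _ w).rank ≤ k →
      ∃ (c : ℂ) (u : Fin m × Fin n → ℂ), (unvec _ _ u).rank ≤ k ∧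
        Φ (vecMulVec w (star w)) = c • vecMulVec u (star u) := by
    intro w hw
    by_cases hw0 : w = 0
    · refine ⟨0, w, hw, ?_⟩
      rw [hw0, zero_vecMulVec, zero_smul]
      exact map_zero Φ.toLinearMap
    · have := smul_vecMulVec_mem_stateMultiples 1 hw0 hw
      rw [Complex.ofReal_one, one_smul] at this
      exact exists_of_mem_stateMultiples (h this)
  obtain ⟨L, hL⟩ := exists_eq_conj_of_rank_le_one Φ hΦ fun a b => by
    obtain ⟨c, u, -, e⟩ := hmap (tensorVec _ _ a b) ((rank_vecMulVec_le a b).trans hk)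
    rw [e]
    exact (rank_smul_le _ _).trans (rank_vecMulVec_le _ _)
  have hconj : ∀ w, Φ (vecMulVec w (star w)) = vecMulVec (L *ᵥ w) (star (L *ᵥ w)) := fun w => by
    rw [hL, mul_vecMulVec_star_mul]
  have hunit : IsUnit L := by
    refine mulVec_injective_iff_isUnit.mp ((injective_iff_map_eq_zero L.mulVecLin).mpr ?_)
    intro w hw
    refine vecMulVec_star_eq_zero (hΦ ?_)
    rw [hconj]
    change L *ᵥ w = 0 at hw
    rw [hw, zero_vecMulVec]
    exact (map_zero Φ.toLinearMap).symm
  refine ⟨L, hunit, isLocalNonsingular_of_rank_le hk hm hn hunit fun w hw => ?_, hL⟩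
  obtain ⟨c, u, hu, e⟩ := hmap w hw
  by_cases hw0 : L *ᵥ w = 0
  · rw [hw0, map_zero, rank_zero]
    exact Nat.zero_le k
  -- A nonzero vector is determined up to a scalar by its projection, so Lw inherits the Schmidt
  -- rank bound of u.
  · rw [hconj, ← smul_vecMulVec] at e
    obtain ⟨d, hd⟩ := eq_smul_of_vecMulVec_eq e (star_ne_zero.mpr hw0)
    rw [hd, smul_smul, map_smul]
    exact (rank_smul_le _ _).trans hu

end Bipartite

open Bipartite in
theorem corollary4p2 (m n k : ℕ) (hk : 1 ≤ k) (hkmn : k < min m n)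
    (Φ : Bipartite.Op m n →CP Bipartite.Op m n) (hΦ : Function.Bijective Φ) :
    (Set.MapsTo Φ (Bipartite.stateMultiples m n k) (Bipartite.stateMultiples m n k) ↔
      ∃ L : Bipartite.Op m n, IsUnit L ∧ Bipartite.IsLocalNonsingular L ∧
        ∀ X : Bipartite.Op m n, Φ X = L * X * Lᴴ) ∧
    ((∀ X : Bipartite.Op m n, (Φ X).trace = X.trace) →
      (Set.MapsTo Φ (Bipartite.stateMultiples m n k) (Bipartite.stateMultiples m n k) ↔
        ∃ L : Bipartite.Op m n, L ∈ Matrix.unitaryGroup (Fin m × Fin n) ℂ ∧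
          Bipartite.IsLocalUnitary L ∧ ∀ X : Bipartite.Op m n, Φ X = L * X * Lᴴ) ∧
      ∀ L : Bipartite.Op m n, Bipartite.IsLocalNonsingular L →
        (∀ X : Bipartite.Op m n, Φ X = L * X * Lᴴ) →
          L ∈ Matrix.unitaryGroup (Fin m × Fin n) ℂ ∧ Bipartite.IsLocalUnitary L) := by
  have hm : k < m := hkmn.trans_le (min_le_left m n)
  have hn : k < n := hkmn.trans_le (min_le_right m n)
  have : NeZero m := ⟨by omega⟩
  have : NeZero n := ⟨by omega⟩
  have forward := exists_isLocalNonsingular hk hm hn Φ hΦ.injective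
  have backward : ∀ L : Op m n, IsLocalNonsingular L → (∀ X, Φ X = L * X * Lᴴ) →
      Set.MapsTo Φ (stateMultiples m n k) (stateMultiples m n k) := fun L hL h X hX => by
    rw [h]
    exact hL.mapsTo hX
  refine ⟨⟨forward, fun ⟨L, _, hL, h⟩ => backward L hL h⟩, fun htr => ?_⟩
  have unitary : ∀ L : Op m n, IsLocalNonsingular L → (∀ X, Φ X = L * X * Lᴴ) →
      L ∈ Matrix.unitaryGroup (Fin m × Fin n) ℂ ∧ IsLocalUnitary L := fun L hL h => by
    have hU := mem_unitaryGroup_of_trace fun X => (h X) ▸ htr X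
    exact ⟨hU, hL.isLocalUnitary hU⟩
  refine ⟨⟨fun hmaps => ?_, fun ⟨L, _, hL, h⟩ => backward L hL.isLocalNonsingular h⟩, unitary⟩
  obtain ⟨L, _, hL, h⟩ := forward hmaps
  exact ⟨L, (unitary L hL h).1, (unitary L hL h).2, h⟩
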